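/- Let $\mathfrak V$ be the Virasoro algebra, i.e. the real Lie algebra with basis $\{L_m : m\in\mathbb Z\}\cup\{C\}$ and relations $$[L_m,L_k]=(m-k)L_{m+k}+\tfrac1{12}\,m(m^2-1)\,\delta_{m,-k}\,C,\qquad [L_m,C]=0\qquad(m,k\in\mathbb Z),$$ and let $\mathfrak W$ be the Witt algebra, i.e. the real Lie algebra with basis $\{L_m : m\in\mathbb Z\}$ and relations $[L_m,L_k]=(m-k)L_{m+k}$. For an open set $U\subseteq\mathbb R^n$, a realization of a real Lie algebra $\mathfrak g$ on $U$ is a Lie algebra homomorphism (not necessarily injective) from $\mathfrak g$ to the Lie algebra of smooth vector fields $\sum_{i=1}^n a_i(x)\,\partial_{x_i}$ on $U$ with the commutator $[Q,P]=QP-PQ$. Let $n\in\{1,2,3\}$ and let $U\subseteq\mathbb R^n$ be open (for instance $U=\mathbb R^n$). Then: (i) There is no realization $\rho$ of $\mathfrak V$ on $U$ with $\rho(C)\neq 0$. (ii) Consequently, the Witt algebra has no nontrivial central extension realized on $U$: if $\pi:E\to\mathfrak W$ is a surjective homomorphism of real Lie algebras whose kernel is contained in the center of $E$, and $E$ has a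 realization on $U$ that is injective on $\ker\pi$, then the extension splits, i.e. there is a Lie algebra homomorphism $\sigma:\mathfrak W\to E$ with $\pi\circ\sigma=\mathrm{id}$. -/

import Mathlib

open scoped ContDiff

noncomputable section

/-! ### The Witt algebra -/

/-- The Witt bracket on the real vector space with basis `e_n`, `n ∈ ℤ`:
`[e_m, e_n] = (m - n) e_{m+n}`, extended bilinearly. -/
def wittBracket : (ℤ →₀ ℝ) →ₗ[ℝ] (ℤ →₀ ℝ) →ₗ[ℝ] (ℤ →₀ ℝ) :=
  Finsupp.linearCombination ℝ fun m : ℤ =>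
    Finsupp.linearCombination ℝ fun n : ℤ =>
      ((m : ℝ) - (n : ℝ)) • Finsupp.single (m + n) (1 : ℝ)

/-- The Virasoro cocycle: `ω(e_m, e_n) = m (m² - 1) / 12` if `m = -n`, and `0` otherwise,
extended bilinearly. -/
def virasoroCocycle : (ℤ →₀ ℝ) →ₗ[ℝ] (ℤ →₀ ℝ) →ₗ[ℝ] ℝ :=
  Finsupp.linearCombination ℝ fun m : ℤ =>
    Finsupp.linearCombination ℝ fun n : ℤ =>
      if m = -n then (1 / 12 : ℝ) * (m : ℝ) * ((m : ℝ) ^ 2 - 1) else 0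

theorem wittBracket_single (m n : ℤ) :
    wittBracket (Finsupp.single m 1) (Finsupp.single n 1) =
      ((m : ℝ) - (n : ℝ)) • Finsupp.single (m + n) (1 : ℝ) := by
  simp [wittBracket]

theorem virasoroCocycle_single (m n : ℤ) :
    virasoroCocycle (Finsupp.single m 1) (Finsupp.single n 1) =
      if m = -n then (1 / 12 : ℝ) * (m : ℝ) * ((m : ℝ) ^ 2 - 1) else 0 := by
  simp [virasoroCocycle]

theorem wittBracket_swap (x y : ℤ →₀ ℝ) : wittBracket x y = -wittBracket y x := by
  induction x using Finsupp.induction_linear with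
  | zero => simp
  | add f g hf hg => simp only [map_add, LinearMap.add_apply, hf, hg]; abel
  | single m a =>
    induction y using Finsupp.induction_linear with
    | zero => simp
    | add f g hf hg => simp only [map_add, LinearMap.add_apply, hf, hg]; abel
    | single n b =>
      rw [← mul_one a, ← mul_one b]
      simp only [← smul_eq_mul (b := (1 : ℝ)), ← Finsupp.smul_single, map_smul,
        LinearMap.smul_apply, wittBracket_single]
      rw [add_comm n m]
      simp only [smul_smul, ← neg_smul]
      congr 1
      ring

theorem virasoroCocycle_swap (x y : ℤ →₀ ℝ) :
    virasoroCocycle x y = -virasoroCocycle y x := by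
  induction x using Finsupp.induction_linear with
  | zero => simp
  | add f g hf hg => simp only [map_add, LinearMap.add_apply, hf, hg]; abel
  | single m a =>
    induction y using Finsupp.induction_linear with
    | zero => simp
    | add f g hf hg => simp only [map_add, LinearMap.add_apply, hf, hg]; abel
    | single n b =>
      rw [← mul_one a, ← mul_one b]
      simp only [← smul_eq_mul (b := (1 : ℝ)), ← Finsupp.smul_single, map_smul,
        LinearMap.smul_apply, virasoroCocycle_single]
      by_cases hmn : m = -n
      · subst hmn
        rw [if_pos rfl, if_pos (neg_neg n).symm]
        simp only [smul_eq_mul]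
        push_cast
        ring
      · rw [if_neg hmn, if_neg (by omega)]
        simp

theorem wittBracket_self (x : ℤ →₀ ℝ) : wittBracket x x = 0 :=
  self_eq_neg.mp (wittBracket_swap x x)

theorem virasoroCocycle_self (x : ℤ →₀ ℝ) : virasoroCocycle x x = 0 :=
  self_eq_neg.mp (virasoroCocycle_swap x x)

theorem wittBracket_jacobi (x y z : ℤ →₀ ℝ) :
    wittBracket x (wittBracket y z) =
      wittBracket (wittBracket x y) z + wittBracket y (wittBracket x z) := by
  induction x using Finsupp.induction_linear with
  | zero => simp
  | add f g hf hg => simp only [map_add, LinearMap.add_apply, hf, hg]; abel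
  | single m a =>
    induction y using Finsupp.induction_linear with
    | zero => simp
    | add f g hf hg => simp only [map_add, LinearMap.add_apply, hf, hg]; abel
    | single n b =>
      induction z using Finsupp.induction_linear with
      | zero => simp
      | add f g hf hg => simp only [map_add, hf, hg]; abel
      | single k c =>
        rw [← mul_one a, ← mul_one b, ← mul_one c]
        simp only [← smul_eq_mul (b := (1 : ℝ)), ← Finsupp.smul_single, map_smul,
          LinearMap.smul_apply, wittBracket_single]
        rw [show m + n + k = m + (n + k) by ring, show n + (m + k) = m + (n + k) by ring]
        simp only [smul_smul, ← add_smul]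
        congr 1
        push_cast
        ring

theorem virasoroCocycle_jacobi (x y z : ℤ →₀ ℝ) :
    virasoroCocycle x (wittBracket y z) =
      virasoroCocycle (wittBracket x y) z + virasoroCocycle y (wittBracket x z) := by
  induction x using Finsupp.induction_linear with
  | zero => simp
  | add f g hf hg => simp only [map_add, LinearMap.add_apply, hf, hg]; abel
  | single m a =>
    induction y using Finsupp.induction_linear with
    | zero => simp
    | add f g hf hg => simp only [map_add, LinearMap.add_apply, hf, hg]; abel
    | single n b =>
      induction z using Finsupp.induction_linear with
      | zero => simp
      | add f g hf hg => simp only [map_add, hf, hg]; abel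
      | single k c =>
        rw [← mul_one a, ← mul_one b, ← mul_one c]
        simp only [← smul_eq_mul (b := (1 : ℝ)), ← Finsupp.smul_single, map_smul,
          LinearMap.smul_apply, wittBracket_single, virasoroCocycle_single]
        by_cases h : m + n + k = 0
        · have h1 : m = -(n + k) := by omega
          have h2 : m + n = -k := by omega
          have h3 : n = -(m + k) := by omega
          rw [if_pos h1, if_pos h2, if_pos h3]
          have hk : (k : ℝ) = -(m : ℝ) - n := by
            have : k = -m - n := by omega
            rw [this]; push_cast; ring
          simp only [smul_eq_mul]
          push_cast
          rw [hk]
          ring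
        · rw [if_neg (by omega), if_neg (by omega), if_neg (by omega)]
          simp

/-- The Witt algebra: the real Lie algebra with basis `L_n`, `n ∈ ℤ`, and
`[L_m, L_n] = (m - n) L_{m+n}`. -/
def Witt : Type := ℤ →₀ ℝ

namespace Witt

instance : AddCommGroup Witt := inferInstanceAs (AddCommGroup (ℤ →₀ ℝ))

instance : Module ℝ Witt := inferInstanceAs (Module ℝ (ℤ →₀ ℝ))

/-- The basis elements `L_n` of the Witt algebra. -/
def L (n : ℤ) : Witt := Finsupp.single n (1 : ℝ)

instance : Bracket Witt Witt := ⟨fun x y => wittBracket x y⟩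

instance : LieRing Witt where
  add_lie x y z := LinearMap.map_add₂ wittBracket x y z
  lie_add x y z := (wittBracket x).map_add y z
  lie_self x := wittBracket_self x
  leibniz_lie x y z := wittBracket_jacobi x y z

instance : LieAlgebra ℝ Witt where
  lie_smul t x y := (wittBracket x).map_smul t y

theorem lie_L_L (m n : ℤ) : ⁅L m, L n⁆ = ((m : ℝ) - (n : ℝ)) • L (m + n) :=
  wittBracket_single m n

end Witt

/-! ### The Virasoro algebra -/

/-- The Virasoro algebra: the real Lie algebra with basis `L_n`, `n ∈ ℤ`, and `C`, with
`[L_m, L_n] = (m - n) L_{m+n} + (1/12) m (m² - 1) δ_{m,-n} C` and `[L_m, C] = 0`.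
A pair `(x, a)` stands for `x + a C`. -/
def Virasoro : Type := (ℤ →₀ ℝ) × ℝ

namespace Virasoro

instance : AddCommGroup Virasoro := inferInstanceAs (AddCommGroup ((ℤ →₀ ℝ) × ℝ))

instance : Module ℝ Virasoro := inferInstanceAs (Module ℝ ((ℤ →₀ ℝ) × ℝ))

/-- The basis elements `L_n` of the Virasoro algebra. -/
def L (n : ℤ) : Virasoro := (Finsupp.single n (1 : ℝ), (0 : ℝ))

/-- The central element of the Virasoro algebra. -/
def C : Virasoro := ((0 : ℤ →₀ ℝ), (1 : ℝ))

instance : Bracket Virasoro Virasoro :=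
  ⟨fun x y => (wittBracket x.1 y.1, virasoroCocycle x.1 y.1)⟩

instance : LieRing Virasoro where
  add_lie x y z := Prod.ext (LinearMap.map_add₂ wittBracket x.1 y.1 z.1)
    (LinearMap.map_add₂ virasoroCocycle x.1 y.1 z.1)
  lie_add x y z := Prod.ext ((wittBracket x.1).map_add y.1 z.1)
    ((virasoroCocycle x.1).map_add y.1 z.1)
  lie_self x := Prod.ext (wittBracket_self x.1) (virasoroCocycle_self x.1)
  leibniz_lie x y z := Prod.ext (wittBracket_jacobi x.1 y.1 z.1)
    (virasoroCocycle_jacobi x.1 y.1 z.1)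

instance : LieAlgebra ℝ Virasoro where
  lie_smul t x y := Prod.ext ((wittBracket x.1).map_smul t y.1)
    ((virasoroCocycle x.1).map_smul t y.1)

theorem lie_L_L (m n : ℤ) :
    ⁅L m, L n⁆ = ((m : ℝ) - (n : ℝ)) • L (m + n) +
      ((1 / 12 : ℝ) * (m : ℝ) * ((m : ℝ) ^ 2 - 1) * (if m = -n then 1 else 0)) • C := by
  refine Prod.ext ?_ ?_
  · change wittBracket (Finsupp.single m 1) (Finsupp.single n 1) =
      ((m : ℝ) - (n : ℝ)) • Finsupp.single (m + n) (1 : ℝ) + _ • (0 : ℤ →₀ ℝ)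
    rw [wittBracket_single, smul_zero, add_zero]
  · change virasoroCocycle (Finsupp.single m 1) (Finsupp.single n 1) =
      ((m : ℝ) - (n : ℝ)) • (0 : ℝ) + _ • (1 : ℝ)
    rw [virasoroCocycle_single, smul_zero, zero_add]
    simp

theorem lie_C (x : Virasoro) : ⁅x, C⁆ = 0 :=
  Prod.ext (wittBracket x.1).map_zero (virasoroCocycle x.1).map_zero

end Virasoro

/-! ### Smooth vector fields on an open subset of Euclidean space -/

/-- The real vector space of smooth vector fields on an open set `U ⊆ ℝⁿ`. A vector field
`∑ V_i ∂_i` on `U` is recorded by its coefficient vector `V`, extended by `0` outside `U`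
so that equality means equality on `U`. -/
def vectorFieldSubmodule {n : ℕ} (U : TopologicalSpace.Opens (EuclideanSpace ℝ (Fin n))) :
    Submodule ℝ (EuclideanSpace ℝ (Fin n) → EuclideanSpace ℝ (Fin n)) where
  carrier := {V | ContDiffOn ℝ ∞ V U ∧ ∀ p, p ∉ U → V p = 0}
  add_mem' hV hW := ⟨hV.1.add hW.1, fun p hp => by simp [hV.2 p hp, hW.2 p hp]⟩
  zero_mem' := ⟨contDiffOn_const, fun _ _ => rfl⟩
  smul_mem' c V hV := ⟨contDiffOn_const.smul hV.1, fun p hp => by simp [hV.2 p hp]⟩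

/-- The Lie algebra of smooth vector fields on an open set `U ⊆ ℝⁿ`. -/
def SmoothVectorField {n : ℕ} (U : TopologicalSpace.Opens (EuclideanSpace ℝ (Fin n))) : Type :=
  vectorFieldSubmodule U

namespace SmoothVectorField

variable {n : ℕ} {U : TopologicalSpace.Opens (EuclideanSpace ℝ (Fin n))}

instance : AddCommGroup (SmoothVectorField U) :=
  inferInstanceAs (AddCommGroup (vectorFieldSubmodule U))

instance : Module ℝ (SmoothVectorField U) :=
  inferInstanceAs (Module ℝ (vectorFieldSubmodule U))

/-- The coefficient vector of a vector field. -/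
def coeff (V : SmoothVectorField U) : EuclideanSpace ℝ (Fin n) → EuclideanSpace ℝ (Fin n) :=
  V.1

theorem contDiffAt (V : SmoothVectorField U) {p : EuclideanSpace ℝ (Fin n)} (hp : p ∈ U) :
    ContDiffAt ℝ ∞ V.coeff p :=
  V.2.1.contDiffAt (U.isOpen.mem_nhds hp)

theorem differentiableAt (V : SmoothVectorField U) {p : EuclideanSpace ℝ (Fin n)}
    (hp : p ∈ U) : DifferentiableAt ℝ V.coeff p :=
  (V.contDiffAt hp).differentiableAt (by simp)

open Classical in
/-- The commutator `[V, W] = VW - WV` of vector fields on `U`, with coefficient vector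
`DW(p) V(p) - DV(p) W(p)` at `p ∈ U`. -/
instance : Bracket (SmoothVectorField U) (SmoothVectorField U) :=
  ⟨fun V W => ⟨fun p => if p ∈ U then VectorField.lieBracket ℝ V.coeff W.coeff p else 0, by
    refine ⟨fun p hp => ?_, fun p hp => if_neg hp⟩
    refine (((V.contDiffAt hp).lieBracket_vectorField (m := ∞) (W.contDiffAt hp)
      (by simp)).congr_of_eventuallyEq ?_).contDiffWithinAt
    filter_upwards [U.isOpen.mem_nhds hp] with q hq
    exact if_pos hq⟩⟩

theorem lie_coeff (V W : SmoothVectorField U) {p : EuclideanSpace ℝ (Fin n)} (hp : p ∈ U) :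
    (⁅V, W⁆ : SmoothVectorField U).coeff p = VectorField.lieBracket ℝ V.coeff W.coeff p :=
  if_pos hp

theorem lie_coeff_eventuallyEq (V W : SmoothVectorField U) {p : EuclideanSpace ℝ (Fin n)}
    (hp : p ∈ U) : (⁅V, W⁆ : SmoothVectorField U).coeff =ᶠ[nhds p]
      VectorField.lieBracket ℝ V.coeff W.coeff := by
  filter_upwards [U.isOpen.mem_nhds hp] with q hq
  exact lie_coeff V W hq

theorem ext_on {V W : SmoothVectorField U} (h : ∀ p ∈ U, V.coeff p = W.coeff p) : V = W := by
  refine Subtype.ext (funext fun p => ?_)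
  by_cases hp : p ∈ U
  · exact h p hp
  · exact (V.2.2 p hp).trans (W.2.2 p hp).symm

theorem add_coeff (V W : SmoothVectorField U) : (V + W).coeff = V.coeff + W.coeff := rfl

theorem smul_coeff (c : ℝ) (V : SmoothVectorField U) : (c • V).coeff = c • V.coeff := rfl

instance : LieRing (SmoothVectorField U) where
  add_lie X Y Z := ext_on fun p hp => by
    rw [lie_coeff _ _ hp, add_coeff, add_coeff, Pi.add_apply, lie_coeff _ _ hp,
      lie_coeff _ _ hp]
    exact VectorField.lieBracket_add_left (X.differentiableAt hp) (Y.differentiableAt hp)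
  lie_add X Y Z := ext_on fun p hp => by
    rw [lie_coeff _ _ hp, add_coeff, add_coeff, Pi.add_apply, lie_coeff _ _ hp,
      lie_coeff _ _ hp]
    exact VectorField.lieBracket_add_right (Y.differentiableAt hp) (Z.differentiableAt hp)
  lie_self X := ext_on fun p hp => by
    rw [lie_coeff _ _ hp, VectorField.lieBracket_self]
    rfl
  leibniz_lie X Y Z := ext_on fun p hp => by
    rw [add_coeff, Pi.add_apply, lie_coeff _ _ hp, lie_coeff _ _ hp, lie_coeff _ _ hp,
      (Filter.EventuallyEq.refl _ X.coeff).lieBracket_vectorField_eq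
        (lie_coeff_eventuallyEq Y Z hp),
      (lie_coeff_eventuallyEq X Y hp).lieBracket_vectorField_eq
        (Filter.EventuallyEq.refl _ Z.coeff),
      (Filter.EventuallyEq.refl _ Y.coeff).lieBracket_vectorField_eq
        (lie_coeff_eventuallyEq X Z hp)]
    exact VectorField.leibniz_identity_lieBracket (n := ∞)
      (by rw [minSmoothness_of_isRCLikeNormedField]; exact WithTop.coe_le_coe.mpr (le_top : (2 : ℕ∞) ≤ ⊤)) (X.contDiffAt hp)
      (Y.contDiffAt hp) (Z.contDiffAt hp)

instance : LieAlgebra ℝ (SmoothVectorField U) where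
  lie_smul t X Y := ext_on fun p hp => by
    rw [lie_coeff _ _ hp, smul_coeff, smul_coeff, Pi.smul_apply, lie_coeff _ _ hp]
    exact VectorField.lieBracket_const_smul_right (Y.differentiableAt hp)

end SmoothVectorField

/-! ### Realizations and central extensions -/

/-- A realization of a real Lie algebra `𝔤` by smooth vector fields on the open set `U ⊆ ℝⁿ`:
a Lie algebra homomorphism from `𝔤` to the vector fields on `U`. It need not be faithful. -/
abbrev Realization (𝔤 : Type*) [LieRing 𝔤] [LieAlgebra ℝ 𝔤] {n : ℕ}
    (U : TopologicalSpace.Opens (EuclideanSpace ℝ (Fin n))) : Type _ :=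
  𝔤 →ₗ⁅ℝ⁆ SmoothVectorField U

/-- `π : E → 𝔤` is a central extension: it is surjective with central kernel. -/
structure IsCentralExtension {E 𝔤 : Type*} [LieRing E] [LieAlgebra ℝ E] [LieRing 𝔤]
    [LieAlgebra ℝ 𝔤] (π : E →ₗ⁅ℝ⁆ 𝔤) : Prop where
  surjective : Function.Surjective π
  central : ∀ z : E, π z = 0 → ∀ x : E, ⁅x, z⁆ = 0

/-- An extension `π : E → 𝔤` splits (is trivial) if `π` has a Lie algebra section. -/
def IsSplitExtension {E 𝔤 : Type*} [LieRing E] [LieAlgebra ℝ E] [LieRing 𝔤]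
    [LieAlgebra ℝ 𝔤] (π : E →ₗ⁅ℝ⁆ 𝔤) : Prop :=
  ∃ σ : 𝔤 →ₗ⁅ℝ⁆ E, ∀ x : 𝔤, π (σ x) = x

end

/-!
The vector fields vanishing at a point form a subalgebra of finite codimension, so no realization of
the Virasoro algebra can be nonzero on `C` once every subalgebra of finite codimension is known to
contain `C`. Identify the Witt algebra with the Laurent polynomials by `L m ↦ T ^ m`; the bracket
becomes `⁅a, b⁆ = D a * b - a * D b` with `D = T d/dT`. The identity
`⁅a, b * g⁆ - ⁅b, a * g⁆ = 2 * ⁅a, b⁆ * g` shows that the image in the Witt algebra of a subalgebra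
`h` of finite codimension contains all multiples of some `f ≠ 0`. Let `x m ∈ h` lie over
`f * T ^ m`. In `⁅x m, x (s - m)⁆` the Witt component `(2 * m - s) * f ^ 2 * T ^ s` is affine in
`m`, while the central component is a cubic polynomial in `m` whose leading coefficient is a twelfth
of the coefficient of `T ^ (-s)` in `f ^ 2`. For a suitable `s` the third difference in `m` is
therefore a nonzero multiple of `C`.

For the second part, every 2-cocycle of the Witt algebra is a multiple of the Virasoro cocycle up to
a coboundary, so every central extension `E` receives a homomorphism from the Virasoro algebra over
the Witt algebra. A realization of `E` kills the image of `C`; if it is injective on the kernel of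
the extension, then that image is zero and the homomorphism descends to a splitting.
-/

noncomputable section

open scoped LaurentPolynomial
open LaurentPolynomial (T)

section FiniteCodimension

variable {R V W : Type*} [Ring R] [AddCommGroup V] [Module R V] [AddCommGroup W] [Module R W]

theorem cofg_comap [IsNoetherianRing R] {N : Submodule R W} (hN : N.CoFG) (f : V →ₗ[R] W) :
    (N.comap f).CoFG := by
  have : Module.Finite R (W ⧸ N) := hN
  rw [← N.ker_mkQ, ← LinearMap.ker_comp]
  exact Submodule.CoFG.ker _

theorem cofg_map_of_surjective {N : Submodule R V} (hN : N.CoFG) {f : V →ₗ[R] W}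
    (hf : Function.Surjective f) : (N.map f).CoFG := by
  have : Module.Finite R (V ⧸ N) := hN
  refine Module.Finite.of_surjective (N.mapQ (N.map f) f (N.le_comap_map f)) ?_
  rw [← LinearMap.range_eq_top, Submodule.range_mapQ, LinearMap.range_eq_top.mpr hf,
    Submodule.map_top, Submodule.range_mkQ]

theorem exists_cofg_forall_lie_mem {K L : Type*} [Field K] [LieRing L] [LieAlgebra K L]
    (h : LieSubalgebra K L) (hh : h.toSubmodule.CoFG) :
    ∃ N : Submodule K L, N.CoFG ∧ ∀ a ∈ N, ∀ x, ⁅a, x⁆ ∈ h := by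
  have : Module.Finite K (L ⧸ h.toSubmodule) := hh
  obtain ⟨F, hF⟩ := h.toSubmodule.exists_isCompl
  have : Module.Finite K F := Module.Finite.equiv (h.toSubmodule.quotientEquivOfIsCompl F hF)
  let g : L →ₗ[K] F →ₗ[K] L ⧸ h.toSubmodule :=
    ((LieAlgebra.ad K L : L →ₗ[K] Module.End K L).compr₂ h.toSubmodule.mkQ).domRestrict₂ F
  refine ⟨h.toSubmodule ⊓ LinearMap.ker g, hh.inf (Submodule.CoFG.ker g), fun a ha x => ?_⟩
  obtain ⟨y, hy, z, hz, rfl⟩ :=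
    Submodule.mem_sup.mp (hF.sup_eq_top ▸ Submodule.mem_top : x ∈ h.toSubmodule ⊔ F)
  have haz : ⁅a, z⁆ ∈ h :=
    (Submodule.Quotient.mk_eq_zero _).mp (LinearMap.congr_fun ha.2 (⟨z, hz⟩ : F))
  rw [lie_add]
  exact h.add_mem (h.lie_mem ha.1 hy) haz

end FiniteCodimension

section LaurentPolynomial

variable {R : Type*} [CommRing R]

theorem laurentPolynomial_linearMap_ext {M : Type*} [AddCommGroup M] [Module R M]
    {f g : R[T;T⁻¹] →ₗ[R] M} (h : ∀ n, f (T n) = g (T n)) : f = g :=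
  AddMonoidAlgebra.lhom_ext' fun n => LinearMap.ext_ring (h n)

theorem T_mul_T_sub (s m : ℤ) : (T m * T (s - m) : R[T;T⁻¹]) = T s := by
  rw [← LaurentPolynomial.T_add, add_sub_cancel]

variable (R) in
/-- The derivation `T d/dT` of the Laurent polynomials, which multiplies `T ^ n` by `n`. -/
def eulerDerivation : Derivation R R[T;T⁻¹] R[T;T⁻¹] :=
  let D : R[T;T⁻¹] →ₗ[R] R[T;T⁻¹] :=
    Finsupp.linearCombination R (fun n : ℤ => (n : R) • (T n : R[T;T⁻¹])) ∘ₗ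
      (AddMonoidAlgebra.coeffLinearEquiv R).toLinearMap
  have hD (n : ℤ) : D (T n) = (n : R) • T n :=
    (Finsupp.linearCombination_single R 1 n).trans (one_smul R _)
  Derivation.mk' D fun f g => by
    suffices (LinearMap.mul R R[T;T⁻¹]).compr₂ D =
        (LinearMap.mul R R[T;T⁻¹]).compl₂ D +
          ((LinearMap.mul R R[T;T⁻¹]).compl₂ D).flip from
      LinearMap.congr_fun₂ this f g
    refine laurentPolynomial_linearMap_ext fun m => laurentPolynomial_linearMap_ext fun n => ?_
    simp only [LinearMap.compr₂_apply, LinearMap.add_apply, LinearMap.flip_apply,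
      LinearMap.compl₂_apply, LinearMap.mul_apply', ← LaurentPolynomial.T_add, hD,
      mul_smul_comm, add_comm n m, ← add_smul, Int.cast_add, add_comm (n : R)]

theorem eulerDerivation_T (n : ℤ) : eulerDerivation R (T n) = (n : R) • T n :=
  (Finsupp.linearCombination_single R 1 n).trans (one_smul R _)

theorem eulerDerivation_mul_T (f : R[T;T⁻¹]) (n : ℤ) :
    eulerDerivation R (f * T n) = (eulerDerivation R f + (n : R) • f) * T n := by
  rw [Derivation.leibniz, eulerDerivation_T, smul_eq_mul, smul_eq_mul, mul_smul_comm, add_mul,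
    smul_mul_assoc, add_comm, mul_comm (T n)]

theorem coeff_eulerDerivation (f : R[T;T⁻¹]) (n : ℤ) :
    (eulerDerivation R f).coeff n = n * f.coeff n := by
  let coeffAt : R[T;T⁻¹] →ₗ[R] R :=
    Finsupp.lapply n ∘ₗ (AddMonoidAlgebra.coeffLinearEquiv R).toLinearMap
  suffices coeffAt ∘ₗ (eulerDerivation R).toLinearMap = (n : R) • coeffAt from
    LinearMap.congr_fun this f
  refine laurentPolynomial_linearMap_ext fun m => ?_
  change (eulerDerivation R (T m)).coeff n = n * (T m : R[T;T⁻¹]).coeff n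
  rw [eulerDerivation_T, AddMonoidAlgebra.coeff_smul, Finsupp.smul_apply, smul_eq_mul,
    LaurentPolynomial.T_apply]
  split_ifs with h <;> simp [h]

theorem coeff_mul_add_of_degree_le {f g : R[T;T⁻¹]} {m n : ℤ} (hf : f.degree ≤ m)
    (hg : g.degree ≤ n) : (f * g).coeff (m + n) = f.coeff m * g.coeff n :=
  AddMonoidAlgebra.coeff_mul_add_of_uniqueAdd fun i j hi hj hij => by
    have him : i ≤ m := WithBot.coe_le_coe.mp ((Finset.le_max hi).trans hf)
    have hjn : j ≤ n := WithBot.coe_le_coe.mp ((Finset.le_max hj).trans hg)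
    lia

theorem degree_eulerDerivation_le (f : R[T;T⁻¹]) : (eulerDerivation R f).degree ≤ f.degree :=
  Finset.max_mono fun n hn => by
    rw [Finsupp.mem_support_iff, coeff_eulerDerivation] at hn
    exact Finsupp.mem_support_iff.mpr (right_ne_zero_of_mul hn)

theorem lie_mul_sub_lie_mul {A : Type*} [CommRing A] [Algebra R A] (D : Derivation R A A)
    (a b g : A) :
    (D a * (b * g) - a * D (b * g)) - (D b * (a * g) - b * D (a * g)) =
      2 * ((D a * b - a * D b) * g) := by
  simp only [Derivation.leibniz, smul_eq_mul]
  ring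

theorem exists_degree_eq_coe {f : R[T;T⁻¹]} (hf : f ≠ 0) :
    ∃ n : ℤ, f.degree = n ∧ f.coeff n ≠ 0 := by
  obtain ⟨n, hn⟩ := WithBot.ne_bot_iff_exists.mp (mt LaurentPolynomial.degree_eq_bot_iff.mp hf)
  exact ⟨n, hn.symm, Finsupp.mem_support_iff.mp (Finset.mem_of_max hn.symm)⟩

theorem eulerDerivation_mul_sub_ne_zero [IsDomain R] [CharZero R] {f g : R[T;T⁻¹]}
    (hf : f ≠ 0) (hg : g ≠ 0) (hfg : f.degree ≠ g.degree) :
    eulerDerivation R f * g - f * eulerDerivation R g ≠ 0 := by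
  obtain ⟨m, hm, hfm⟩ := exists_degree_eq_coe hf
  obtain ⟨n, hn, hgn⟩ := exists_degree_eq_coe hg
  have hmn : (m : R) - n ≠ 0 := by
    rw [sub_ne_zero, Int.cast_injective.ne_iff]
    rintro rfl
    exact hfg (hm.trans hn.symm)
  have htop : (eulerDerivation R f * g - f * eulerDerivation R g).coeff (m + n) =
      (m - n) * (f.coeff m * g.coeff n) := by
    rw [AddMonoidAlgebra.coeff_sub, Finsupp.sub_apply,
      coeff_mul_add_of_degree_le ((degree_eulerDerivation_le f).trans hm.le) hn.le,
      coeff_mul_add_of_degree_le hm.le ((degree_eulerDerivation_le g).trans hn.le),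
      coeff_eulerDerivation, coeff_eulerDerivation]
    ring
  intro h
  rw [h] at htop
  exact mul_ne_zero hmn (mul_ne_zero hfm hgn) htop.symm

theorem exists_mem_lt_degree {K : Type*} [Field K] {N : Submodule K K[T;T⁻¹]} (hN : N.CoFG)
    (d : WithBot ℤ) : ∃ f ∈ N, d < f.degree := by
  obtain ⟨m, hm⟩ : ∃ m : ℤ, d ≤ m := by
    cases d with
    | bot => exact ⟨0, bot_le⟩
    | coe m => exact ⟨m, le_rfl⟩
  let S : Submodule K K[T;T⁻¹] := AddMonoidAlgebra.supported K K (Set.Ioi m)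
  have hS : ¬ S.FG := by
    rw [← Module.Finite.iff_fg, Module.Finite.equiv_iff (AddMonoidAlgebra.supportedEquivFinsupp _),
      Module.finite_finsupp_iff]
    simp [not_subsingleton K, Set.infinite_coe_iff, Set.Ioi_infinite m]
  obtain ⟨f, ⟨hfS, hfN⟩, hf⟩ := Submodule.exists_mem_ne_zero_of_ne_bot
    (mt disjoint_iff.mpr (mt (fun h => hN.fg_of_disjoint h) hS))
  obtain ⟨n, hn, hfn⟩ := exists_degree_eq_coe hf
  refine ⟨f, hfN, hm.trans_lt ?_⟩
  rw [hn, WithBot.coe_lt_coe]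
  exact AddMonoidAlgebra.mem_supported.mp hfS (Finsupp.mem_support_iff.mpr hfn)

end LaurentPolynomial

namespace Witt

/-- The Witt algebra as the space of Laurent polynomials, with `L m` corresponding to `T ^ m`. -/
def toLaurent : Witt ≃ₗ[ℝ] ℝ[T;T⁻¹] :=
  (AddMonoidAlgebra.coeffLinearEquiv ℝ).symm

theorem toLaurent_L (m : ℤ) : toLaurent (L m) = T m := rfl

theorem linearMap_ext {M : Type*} [AddCommGroup M] [Module ℝ M] {f g : Witt →ₗ[ℝ] M}
    (h : ∀ m, f (L m) = g (L m)) : f = g :=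
  Finsupp.lhom_ext' fun m => LinearMap.ext_ring (h m)

theorem bilin_ext {M : Type*} [AddCommGroup M] [Module ℝ M] {f g : Witt →ₗ[ℝ] Witt →ₗ[ℝ] M}
    (h : ∀ m n, f (L m) (L n) = g (L m) (L n)) : f = g :=
  linearMap_ext fun m => linearMap_ext (h m)

theorem toLaurent_lie (x y : Witt) :
    toLaurent ⁅x, y⁆ = eulerDerivation ℝ (toLaurent x) * toLaurent y -
      toLaurent x * eulerDerivation ℝ (toLaurent y) := by
  let mulD : Witt →ₗ[ℝ] Witt →ₗ[ℝ] ℝ[T;T⁻¹] :=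
    (LinearMap.mul ℝ ℝ[T;T⁻¹]).compl₁₂
      ((eulerDerivation ℝ).toLinearMap ∘ₗ toLaurent.toLinearMap) toLaurent.toLinearMap
  suffices (wittBracket : Witt →ₗ[ℝ] Witt →ₗ[ℝ] Witt).compr₂ toLaurent.toLinearMap =
      mulD - mulD.flip by
    rw [mul_comm (toLaurent x)]
    exact LinearMap.congr_fun₂ this x y
  refine bilin_ext fun m n => ?_
  change toLaurent ⁅L m, L n⁆ = eulerDerivation ℝ (T m) * T n - eulerDerivation ℝ (T n) * T m
  rw [lie_L_L, map_smul, toLaurent_L, eulerDerivation_T, eulerDerivation_T, smul_mul_assoc,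
    smul_mul_assoc, ← LaurentPolynomial.T_add, ← LaurentPolynomial.T_add, add_comm n, sub_smul]

theorem lie_toLaurent_symm (f g : ℝ[T;T⁻¹]) : ⁅toLaurent.symm f, toLaurent.symm g⁆ =
    toLaurent.symm (eulerDerivation ℝ f * g - f * eulerDerivation ℝ g) := by
  rw [LinearEquiv.eq_symm_apply, toLaurent_lie, LinearEquiv.apply_symm_apply,
    LinearEquiv.apply_symm_apply]

theorem lie_mul_T (f : ℝ[T;T⁻¹]) (s m : ℤ) :
    ⁅toLaurent.symm (f * T m), toLaurent.symm (f * T (s - m))⁆ =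
      (2 * (m : ℝ) - s) • toLaurent.symm (f * f * T s) := by
  rw [lie_toLaurent_symm, eulerDerivation_mul_T, eulerDerivation_mul_T, ← map_smul,
    ← T_mul_T_sub s m]
  congr 1
  simp only [Algebra.smul_def, map_sub, map_mul, Int.cast_sub, map_ofNat]
  ring

theorem virasoroCocycle_eq_coeff (x y : Witt) :
    virasoroCocycle x y = 1 / 12 *
      ((eulerDerivation ℝ (eulerDerivation ℝ (eulerDerivation ℝ (toLaurent x))) -
        eulerDerivation ℝ (toLaurent x)) * toLaurent y).coeff 0 := by
  let D : Witt →ₗ[ℝ] ℝ[T;T⁻¹] := (eulerDerivation ℝ).toLinearMap ∘ₗ toLaurent.toLinearMap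
  let coeffZero : ℝ[T;T⁻¹] →ₗ[ℝ] ℝ :=
    Finsupp.lapply 0 ∘ₗ (AddMonoidAlgebra.coeffLinearEquiv ℝ).toLinearMap
  suffices virasoroCocycle = (1 / 12 : ℝ) • ((LinearMap.mul ℝ ℝ[T;T⁻¹]).compl₁₂
      ((eulerDerivation ℝ).toLinearMap ∘ₗ (eulerDerivation ℝ).toLinearMap ∘ₗ D - D)
      toLaurent.toLinearMap).compr₂ coeffZero from LinearMap.congr_fun₂ this x y
  refine bilin_ext fun m n => (virasoroCocycle_single m n).trans ?_
  change _ = 1 / 12 * ((eulerDerivation ℝ (eulerDerivation ℝ (eulerDerivation ℝ (T m))) -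
        eulerDerivation ℝ (T m)) * T n).coeff 0
  simp only [eulerDerivation_T, Derivation.map_smul, sub_mul, smul_mul_assoc,
    ← LaurentPolynomial.T_add, AddMonoidAlgebra.coeff_sub, AddMonoidAlgebra.coeff_smul,
    Finsupp.sub_apply, Finsupp.smul_apply, LaurentPolynomial.T_apply, smul_eq_mul,
    eq_neg_iff_add_eq_zero]
  split_ifs <;> ring

theorem exists_virasoroCocycle_mul_T (f : ℝ[T;T⁻¹]) (s : ℤ) : ∃ a b c : ℝ, ∀ m : ℤ,
    virasoroCocycle (toLaurent.symm (f * T m)) (toLaurent.symm (f * T (s - m))) =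
      a + b * m + c * m ^ 2 + (f * f).coeff (-s) / 12 * m ^ 3 := by
  let D := eulerDerivation ℝ
  have hcubic (m : ℤ) : (D (D (D (f * T m))) - D (f * T m)) * (f * T (s - m)) =
      ((D (D (D f)) - D f) + (m : ℝ) • (3 * D (D f) - f) + (m : ℝ) ^ 2 • (3 * D f) +
        (m : ℝ) ^ 3 • f) * f * T s := by
    simp only [D, eulerDerivation_mul_T, map_add, Derivation.map_smul, ← T_mul_T_sub s m]
    simp only [Algebra.smul_def, map_pow]
    ring
  have hf : (f * f).coeff (-s) = (f * f * T s).coeff 0 := by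
    rw [T, AddMonoidAlgebra.coeff_mul_single_apply, zero_add, mul_one]
  let A (g : ℝ[T;T⁻¹]) : ℝ := (g * f * T s).coeff 0 / 12
  refine ⟨A (D (D (D f)) - D f), A (3 * D (D f) - f), A (3 * D f), fun m => ?_⟩
  rw [virasoroCocycle_eq_coeff, hf]
  simp only [LinearEquiv.apply_symm_apply]
  rw [hcubic m]
  simp only [A, add_mul _ _ f, add_mul _ _ (T s), smul_mul_assoc, AddMonoidAlgebra.coeff_add,
    AddMonoidAlgebra.coeff_smul, Finsupp.add_apply, Finsupp.smul_apply, smul_eq_mul]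
  ring

theorem exists_forall_mul_mem (h : LieSubalgebra ℝ Witt) (hh : h.toSubmodule.CoFG) :
    ∃ f ≠ 0, ∀ g, toLaurent.symm (f * g) ∈ h := by
  obtain ⟨N, hN, hNh⟩ := exists_cofg_forall_lie_mem h hh
  have hN' : (N.comap toLaurent.symm.toLinearMap).CoFG := cofg_comap hN _
  obtain ⟨a, haN, ha⟩ := exists_mem_lt_degree hN' ⊥
  obtain ⟨b, hbN, hab⟩ := exists_mem_lt_degree hN' a.degree
  have ha0 : a ≠ 0 := mt LaurentPolynomial.degree_eq_bot_iff.mpr ha.ne'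
  have hb0 : b ≠ 0 := mt LaurentPolynomial.degree_eq_bot_iff.mpr (ha.trans hab).ne'
  refine ⟨_, eulerDerivation_mul_sub_ne_zero ha0 hb0 hab.ne, fun g => ?_⟩
  have hmem : (1 / 2 : ℝ) • (⁅toLaurent.symm a, toLaurent.symm (b * g)⁆ -
      ⁅toLaurent.symm b, toLaurent.symm (a * g)⁆) ∈ h :=
    h.smul_mem _ (h.sub_mem (hNh _ haN _) (hNh _ hbN _))
  rw [lie_toLaurent_symm, lie_toLaurent_symm, ← map_sub, lie_mul_sub_lie_mul, ← map_smul] at hmem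
  convert hmem using 2
  rw [two_mul, ← two_smul ℝ, smul_smul]
  norm_num

end Witt

namespace Virasoro

/-- The projection of the Virasoro algebra onto the Witt algebra. -/
def toWitt : Virasoro →ₗ⁅ℝ⁆ Witt :=
  { LinearMap.fst ℝ (ℤ →₀ ℝ) ℝ with map_lie' := rfl }

/-- The linear section `L m ↦ L m` of the projection `Virasoro.toWitt`; it is not a homomorphism
of Lie algebras. -/
def ofWitt : Witt →ₗ[ℝ] Virasoro :=
  LinearMap.inl ℝ (ℤ →₀ ℝ) ℝ

theorem toWitt_surjective : Function.Surjective toWitt :=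
  fun x => ⟨ofWitt x, rfl⟩

theorem eq_ofWitt_add_smul_C (x : Virasoro) : x = ofWitt (toWitt x) + x.2 • C :=
  Prod.ext (by change x.1 = x.1 + x.2 • 0; simp) (by change x.2 = 0 + x.2 • 1; simp)

theorem lie_eq (x y : Virasoro) :
    ⁅x, y⁆ = ofWitt ⁅toWitt x, toWitt y⁆ + virasoroCocycle (toWitt x) (toWitt y) • C :=
  eq_ofWitt_add_smul_C _

theorem thirdDiff_lie_eq {f : ℝ[T;T⁻¹]} {x : ℤ → Virasoro}
    (hx : ∀ m, toWitt (x m) = Witt.toLaurent.symm (f * T m)) (s : ℤ) :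
    ⁅x 3, x (s - 3)⁆ - (3 : ℝ) • ⁅x 2, x (s - 2)⁆ + (3 : ℝ) • ⁅x 1, x (s - 1)⁆ - ⁅x 0, x s⁆ =
      ((f * f).coeff (-s) / 2) • C := by
  obtain ⟨a, b, c, habc⟩ := Witt.exists_virasoroCocycle_mul_T f s
  have hlie (m : ℤ) : ⁅x m, x (s - m)⁆ =
      (2 * (m : ℝ) - s) • ofWitt (Witt.toLaurent.symm (f * f * T s)) +
        (a + b * m + c * m ^ 2 + (f * f).coeff (-s) / 12 * m ^ 3) • C := by
    rw [lie_eq, hx, hx, Witt.lie_mul_T, habc, map_smul]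
  have hzero : ⁅x 0, x s⁆ = ⁅x 0, x (s - 0)⁆ := by rw [sub_zero]
  rw [hzero, hlie, hlie, hlie, hlie]
  push_cast
  module

theorem C_mem_of_cofg {h : LieSubalgebra ℝ Virasoro} (hh : h.toSubmodule.CoFG) : C ∈ h := by
  obtain ⟨f, hf, hfh⟩ := Witt.exists_forall_mul_mem (h.map toWitt)
    (cofg_map_of_surjective hh toWitt_surjective)
  choose x hxh hx using fun m => hfh (T m)
  obtain ⟨k, hk⟩ := Finsupp.ne_iff.mp (AddMonoidAlgebra.coeff_eq_zero.not.mpr (mul_ne_zero hf hf))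
  have hlie (m n : ℤ) : ⁅x m, x n⁆ ∈ h := h.lie_mem (hxh m) (hxh n)
  have hmem : ((f * f).coeff k / 2) • C ∈ h := by
    rw [← neg_neg k, ← thirdDiff_lie_eq hx (-k)]
    exact h.sub_mem (h.add_mem (h.sub_mem (hlie _ _) (h.smul_mem _ (hlie _ _)))
      (h.smul_mem _ (hlie _ _))) (hlie _ _)
  exact (h.toSubmodule.smul_mem_iff (div_ne_zero hk two_ne_zero)).mp hmem

end Virasoro

namespace SmoothVectorField

variable {n : ℕ} {U : TopologicalSpace.Opens (EuclideanSpace ℝ (Fin n))}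

/-- Evaluation of vector fields at a point, as a linear map. -/
def evalAt (p : EuclideanSpace ℝ (Fin n)) : SmoothVectorField U →ₗ[ℝ] EuclideanSpace ℝ (Fin n) where
  toFun V := V.coeff p
  map_add' _ _ := rfl
  map_smul' _ _ := rfl

/-- The isotropy subalgebra of a point of `U`: the vector fields which vanish there. -/
def isotropy {p : EuclideanSpace ℝ (Fin n)} (hp : p ∈ U) :
    LieSubalgebra ℝ (SmoothVectorField U) where
  __ := LinearMap.ker (evalAt p)
  lie_mem' {V W} hV hW := by
    have hV : V.coeff p = 0 := hV
    have hW : W.coeff p = 0 := hW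
    change ⁅V, W⁆.coeff p = 0
    rw [lie_coeff _ _ hp, VectorField.lieBracket, hV, hW, map_zero, map_zero, sub_zero]

theorem cofg_isotropy {p : EuclideanSpace ℝ (Fin n)} (hp : p ∈ U) :
    (isotropy hp).toSubmodule.CoFG :=
  Submodule.CoFG.ker (evalAt p)

theorem realization_C_eq_zero (ρ : Realization Virasoro U) : ρ Virasoro.C = 0 :=
  ext_on fun _ hp =>
    Virasoro.C_mem_of_cofg (h := (isotropy hp).comap ρ) (cofg_comap (cofg_isotropy hp) _)

end SmoothVectorField

/-- The 2-cocycles of the Witt algebra over `K` with values in a trivial module, in terms of their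
values `c m n` on the pairs `(L m, L n)` of basis elements. -/
structure IsWittCocycle (K : Type*) {M : Type*} [CommRing K] [AddCommGroup M]
    [Module K M] (c : ℤ → ℤ → M) : Prop where
  skew : ∀ m n : ℤ, c n m = -c m n
  jacobi : ∀ l m n : ℤ, ((m : K) - n) • c l (m + n) =
    ((l : K) - m) • c (l + m) n + ((l : K) - n) • c m (l + n)

namespace IsWittCocycle

section CommRing

variable {K M : Type*} [CommRing K] [AddCommGroup M] [Module K M] {c : ℤ → ℤ → M}

theorem sub_coboundary (hc : IsWittCocycle K c) (b : ℤ → M) :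
    IsWittCocycle K fun m n => c m n - ((m : K) - n) • b (m + n) where
  skew m n := by
    rw [hc.skew, add_comm n m]
    module
  jacobi l m n := by
    rw [smul_sub, hc.jacobi, add_left_comm m l n, add_assoc]
    push_cast
    module

theorem smul_apply_succ (hc : IsWittCocycle K c) (h₁ : c 1 (-1) = 0) (m : ℤ) :
    ((m : K) - 1) • c (m + 1) (-(m + 1)) = ((m : K) + 2) • c m (-m) := by
  have h := hc.jacobi 1 m (-(m + 1))
  rw [show m + -(m + 1) = -1 by ring, show 1 + -(m + 1) = -m by ring, add_comm 1 m, h₁,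
    smul_zero] at h
  push_cast at h
  linear_combination (norm := module) h

end CommRing

variable {K M : Type*} [Field K] [CharZero K] [AddCommGroup M] [Module K M] {c : ℤ → ℤ → M}

theorem apply_zero_zero (hc : IsWittCocycle K c) : c 0 0 = 0 := by
  have h : (2 : K) • c 0 0 = 0 := by
    rw [two_smul]
    nth_rw 1 [hc.skew]
    exact neg_add_cancel _
  exact (smul_eq_zero_iff_right two_ne_zero).mp h

theorem apply_eq_zero (hc : IsWittCocycle K c) (h₀ : ∀ n, c 0 n = 0) {m n : ℤ} (hmn : m + n ≠ 0) :
    c m n = 0 := by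
  have h := hc.jacobi 0 m n
  rw [h₀, smul_zero, zero_add, zero_add, ← add_smul] at h
  refine (smul_eq_zero_iff_right (r := (m + n : K)) (by exact_mod_cast hmn)).mp ?_
  rw [← neg_eq_zero, ← neg_smul, h]
  congr 1
  push_cast
  ring

theorem apply_neg (hc : IsWittCocycle K c) (h₀ : ∀ n, c 0 n = 0) (h₁ : c 1 (-1) = 0) (m : ℤ) :
    c m (-m) = ((m : K) * ((m : K) ^ 2 - 1) / 6) • c 2 (-2) := by
  have hnonneg (k : ℤ) (hk : 0 ≤ k) : c k (-k) = ((k : K) * ((k : K) ^ 2 - 1) / 6) • c 2 (-2) := by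
    rcases (by lia : k = 0 ∨ k = 1 ∨ 2 ≤ k) with rfl | rfl | hk
    · simp [h₀]
    · simp [h₁]
    · induction k, hk using Int.leInduction with
      | base => norm_num
      | succ k hk ih =>
        have hk1 : (k : K) - 1 ≠ 0 := by exact_mod_cast (by lia : k - 1 ≠ 0)
        rw [← smul_right_inj hk1, hc.smul_apply_succ h₁, ih (by lia), smul_smul, smul_smul]
        congr 1
        push_cast
        ring
  rcases le_total 0 m with hm | hm
  · exact hnonneg m hm
  · have h := hnonneg (-m) (neg_nonneg.mpr hm)
    rw [neg_neg, hc.skew] at h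
    rw [← neg_inj, h, ← neg_smul]
    congr 1
    push_cast
    ring

theorem exists_eq_coboundary_add (hc : IsWittCocycle K c) : ∃ (b : ℤ → M) (z : M), ∀ m n,
    c m n = ((m : K) - n) • b (m + n) +
      (if m = -n then (1 / 12 : K) * m * ((m : K) ^ 2 - 1) else 0) • z := by
  let b (k : ℤ) : M := if k = 0 then (1 / 2 : K) • c 1 (-1) else (-(k : K)⁻¹) • c 0 k
  let c' (m n : ℤ) : M := c m n - ((m : K) - n) • b (m + n)
  have hc' : IsWittCocycle K c' := hc.sub_coboundary b
  have h₀ (n : ℤ) : c' 0 n = 0 := by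
    rcases eq_or_ne n 0 with rfl | hn
    · exact hc'.apply_zero_zero
    · have hnK : (n : K) ≠ 0 := Int.cast_ne_zero.mpr hn
      simp only [c', b, zero_add, if_neg hn, smul_smul, Int.cast_zero, zero_sub, neg_mul_neg,
        mul_inv_cancel₀ hnK, one_smul, sub_self]
  have h₁ : c' 1 (-1) = 0 := by
    simp only [c', b, add_neg_cancel, if_true]
    push_cast
    module
  refine ⟨b, (2 : K) • c' 2 (-2), fun m n => ?_⟩
  rw [← sub_eq_iff_eq_add']
  change c' m n = _
  split_ifs with hmn
  · obtain rfl : n = -m := by lia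
    rw [hc'.apply_neg h₀ h₁, smul_smul]
    congr 1
    ring
  · rw [zero_smul, hc'.apply_eq_zero h₀ (by lia)]

end IsWittCocycle

namespace Virasoro

variable {E : Type*} [LieRing E] [LieAlgebra ℝ E]

/-- The Virasoro relations for elements `e m` and `z` of a Lie algebra, in the roles of `L m` and
`C`. -/
structure Relations (e : ℤ → E) (z : E) : Prop where
  lie_eq : ∀ m n, ⁅e m, e n⁆ = ((m : ℝ) - n) • e (m + n) +
    (if m = -n then (1 / 12 : ℝ) * m * ((m : ℝ) ^ 2 - 1) else 0) • z
  lie_central : ∀ m, ⁅e m, z⁆ = 0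

namespace Relations

variable {e : ℤ → E} {z : E}

theorem lie_linearCombination (h : Relations e z) (x y : ℤ →₀ ℝ) :
    ⁅Finsupp.linearCombination ℝ e x, Finsupp.linearCombination ℝ e y⁆ =
      Finsupp.linearCombination ℝ e (wittBracket x y) + virasoroCocycle x y • z := by
  let s : Witt →ₗ[ℝ] E := Finsupp.linearCombination ℝ e
  let bracket : E →ₗ[ℝ] E →ₗ[ℝ] E := LieModule.toEnd ℝ E E
  suffices bracket.compl₁₂ s s = (wittBracket : Witt →ₗ[ℝ] Witt →ₗ[ℝ] Witt).compr₂ s +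
      (virasoroCocycle : Witt →ₗ[ℝ] Witt →ₗ[ℝ] ℝ).compr₂ (LinearMap.toSpanSingleton ℝ E z) from
    LinearMap.congr_fun₂ this x y
  refine Witt.bilin_ext fun m n => ?_
  have hs (k : ℤ) : s (Witt.L k) = e k :=
    (Finsupp.linearCombination_single ℝ 1 k).trans (one_smul ℝ _)
  change ⁅s (Witt.L m), s (Witt.L n)⁆ =
    s ⁅Witt.L m, Witt.L n⁆ + virasoroCocycle (Witt.L m) (Witt.L n) • z
  rw [Witt.lie_L_L, map_smul, hs, hs, hs, h.lie_eq]
  exact congrArg (_ + · • z) (virasoroCocycle_single m n).symm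

theorem linearCombination_lie_central (h : Relations e z) (x : ℤ →₀ ℝ) :
    ⁅Finsupp.linearCombination ℝ e x, z⁆ = 0 := by
  simp only [Finsupp.linearCombination_apply, Finsupp.sum, sum_lie, smul_lie,
    h.lie_central, smul_zero, Finset.sum_const_zero]

/-- The homomorphism from the Virasoro algebra with `L m ↦ e m` and `C ↦ z`. -/
def lift (h : Relations e z) : Virasoro →ₗ⁅ℝ⁆ E where
  __ := ((Finsupp.linearCombination ℝ e).coprod (LinearMap.toSpanSingleton ℝ E z) :
    (ℤ →₀ ℝ) × ℝ →ₗ[ℝ] E)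
  map_lie' {x y} := by
    have hz (w : ℤ →₀ ℝ) : ⁅z, Finsupp.linearCombination ℝ e w⁆ = 0 := by
      rw [← lie_skew, h.linearCombination_lie_central, neg_zero]
    change Finsupp.linearCombination ℝ e (wittBracket x.1 y.1) + virasoroCocycle x.1 y.1 • z =
      ⁅Finsupp.linearCombination ℝ e x.1 + x.2 • z, Finsupp.linearCombination ℝ e y.1 + y.2 • z⁆
    simp only [lie_add, add_lie, lie_smul, smul_lie, lie_self, hz, h.linearCombination_lie_central,
      smul_zero, add_zero, h.lie_linearCombination]

theorem lift_apply (h : Relations e z) (x : Virasoro) :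
    h.lift x = Finsupp.linearCombination ℝ e x.1 + x.2 • z :=
  rfl

end Relations

theorem isSplitExtension_of_hom {π : E →ₗ⁅ℝ⁆ Witt} (φ : Virasoro →ₗ⁅ℝ⁆ E)
    (hφ : ∀ x, π (φ x) = toWitt x) (hC : φ C = 0) : IsSplitExtension π := by
  refine ⟨{ φ.toLinearMap ∘ₗ ofWitt with map_lie' := fun {x y} => ?_ }, fun x => hφ (ofWitt x)⟩
  have h := φ.map_lie (ofWitt x) (ofWitt y)
  rw [lie_eq, map_add, map_smul, hC, smul_zero, add_zero] at h
  exact h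

end Virasoro

namespace IsCentralExtension

variable {E 𝔤 : Type*} [LieRing E] [LieAlgebra ℝ E] [LieRing 𝔤] [LieAlgebra ℝ 𝔤]

theorem lie_eq_of_map_eq {π : E →ₗ⁅ℝ⁆ 𝔤} (hπ : IsCentralExtension π) {x x' y y' : E}
    (hx : π x = π x') (hy : π y = π y') : ⁅x, y⁆ = ⁅x', y'⁆ := by
  have h₁ : ⁅x, y - y'⁆ = 0 := hπ.central _ (by rw [map_sub, hy, sub_self]) _
  have h₂ : ⁅y', x - x'⁆ = 0 := hπ.central _ (by rw [map_sub, hx, sub_self]) _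
  rw [lie_sub, sub_eq_zero] at h₁ h₂
  rw [h₁, ← lie_skew, h₂, lie_skew]

variable {π : E →ₗ⁅ℝ⁆ Witt}

/-- The failure of lifts `l m` of the `L m` to satisfy the Witt relations, as a function with values
in the kernel of the extension. -/
def defect {l : ℤ → E} (hl : ∀ m, π (l m) = Witt.L m) (m n : ℤ) :
    LinearMap.ker (π : E →ₗ[ℝ] Witt) :=
  ⟨⁅l m, l n⁆ - ((m : ℝ) - n) • l (m + n), by
    change π _ = 0
    rw [map_sub, map_smul, LieHom.map_lie, hl, hl, hl, Witt.lie_L_L, sub_self]⟩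

theorem lie_eq_add_defect {l : ℤ → E} (hl : ∀ m, π (l m) = Witt.L m) (m n : ℤ) :
    ⁅l m, l n⁆ = ((m : ℝ) - n) • l (m + n) + defect hl m n :=
  (add_sub_cancel _ _).symm

theorem isWittCocycle_defect (hπ : IsCentralExtension π) {l : ℤ → E}
    (hl : ∀ m, π (l m) = Witt.L m) : IsWittCocycle ℝ (defect hl) where
  skew m n := by
    apply Subtype.ext
    change ⁅l n, l m⁆ - _ = -(⁅l m, l n⁆ - _)
    rw [← lie_skew, add_comm n m]
    module
  jacobi k m n := by
    have hd (i j : ℤ) (x : E) : ⁅x, (defect hl i j : E)⁆ = 0 := hπ.central _ (defect hl i j).2 x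
    have hd' (i j : ℤ) (x : E) : ⁅(defect hl i j : E), x⁆ = 0 := by rw [← lie_skew, hd, neg_zero]
    have h := leibniz_lie (l k) (l m) (l n)
    simp only [lie_eq_add_defect hl m n, lie_eq_add_defect hl k m, lie_eq_add_defect hl k n,
      lie_add, add_lie, lie_smul, smul_lie, hd, hd', add_zero] at h
    rw [lie_eq_add_defect hl k, lie_eq_add_defect hl (k + m), lie_eq_add_defect hl m,
      add_assoc k, add_left_comm m k] at h
    apply Subtype.ext
    change ((m : ℝ) - n) • (defect hl k (m + n) : E) =
      ((k : ℝ) - m) • (defect hl (k + m) n : E) + ((k : ℝ) - n) • (defect hl m (k + n) : E)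
    push_cast at h
    linear_combination (norm := module) h

theorem exists_hom_virasoro (hπ : IsCentralExtension π) :
    ∃ φ : Virasoro →ₗ⁅ℝ⁆ E, ∀ x, π (φ x) = Virasoro.toWitt x := by
  choose l hl using fun m => hπ.surjective (Witt.L m)
  obtain ⟨b, z, hbz⟩ := (hπ.isWittCocycle_defect hl).exists_eq_coboundary_add
  have he (m : ℤ) : π (l m + b m) = Witt.L m := by
    rw [map_add, hl, show π (b m) = 0 from (b m).2, add_zero]
  have hrel : Virasoro.Relations (fun m => l m + b m) (z : E) := by
    refine ⟨fun m n => ?_, fun m => hπ.central _ z.2 _⟩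
    rw [hπ.lie_eq_of_map_eq ((he m).trans (hl m).symm) ((he n).trans (hl n).symm),
      lie_eq_add_defect hl, hbz, smul_add, add_assoc]
    rfl
  refine ⟨hrel.lift, fun x => ?_⟩
  have hid : (π : E →ₗ[ℝ] Witt) ∘ₗ Finsupp.linearCombination ℝ (fun m => l m + b m : ℤ → E) =
      (LinearMap.id : Witt →ₗ[ℝ] Witt) :=
    Witt.linearMap_ext fun m => by
      change π (Finsupp.linearCombination ℝ _ (Finsupp.single m 1)) = Witt.L m
      rw [Finsupp.linearCombination_single, one_smul, he]
  rw [hrel.lift_apply, map_add, map_smul, show π z = 0 from z.2, smul_zero, add_zero]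
  exact LinearMap.congr_fun hid x.1

theorem isSplitExtension_of_realization (hπ : IsCentralExtension π) {n : ℕ}
    {U : TopologicalSpace.Opens (EuclideanSpace ℝ (Fin n))} (ρ : Realization E U)
    (hρ : ∀ z : E, π z = 0 → ρ z = 0 → z = 0) : IsSplitExtension π := by
  obtain ⟨φ, hφ⟩ := hπ.exists_hom_virasoro
  exact Virasoro.isSplitExtension_of_hom φ hφ
    (hρ _ (hφ Virasoro.C) (SmoothVectorField.realization_C_eq_zero (ρ.comp φ)))

end IsCentralExtension

end

theorem theorem4_general (n : ℕ) (U : TopologicalSpace.Opens (EuclideanSpace ℝ (Fin n))) :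
    (¬ ∃ ρ : Realization Virasoro U, ρ Virasoro.C ≠ 0) ∧
    (∀ (E : Type*) [LieRing E] [LieAlgebra ℝ E] (π : E →ₗ⁅ℝ⁆ Witt) (ρ : Realization E U),
      IsCentralExtension π → (∀ z : E, π z = 0 → ρ z = 0 → z = 0) →
        IsSplitExtension π) :=
  ⟨fun ⟨ρ, hρ⟩ => hρ (SmoothVectorField.realization_C_eq_zero ρ),
    fun _ _ _ _ ρ hπ hρ => hπ.isSplitExtension_of_realization ρ hρ⟩

theorem theorem4 (n : ℕ) (hn : n = 1 ∨ n = 2 ∨ n = 3)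
    (U : TopologicalSpace.Opens (EuclideanSpace ℝ (Fin n))) :
    (¬ ∃ ρ : Realization Virasoro U, ρ Virasoro.C ≠ 0) ∧
    (∀ (E : Type*) [LieRing E] [LieAlgebra ℝ E] (π : E →ₗ⁅ℝ⁆ Witt) (ρ : Realization E U),
      IsCentralExtension π → (∀ z : E, π z = 0 → ρ z = 0 → z = 0) →
        IsSplitExtension π) :=
  theorem4_general n U
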